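/- Let $f:\mathbb{R}^2\setminus\{y=0\}\to\mathbb{R}^2\setminus\{y=-x\}$, $f(x,y)=\left(x+\frac1y,\;y-\frac1y-x\right)$, be the Hénon–Devaney map, a bijection with inverse $f^{-1}(x,y)=\left(x-\frac1{x+y},\;x+y\right)$. For $n\ge 0$ let $f^{-n}(\{y=0\})$ be the set of points at which $f^n$ is defined and has its value on the line $\{y=0\}$, and let $f^{n}(\{y=-x\})$ be the set of values of $f^n$ at those points of the line $\{y=-x\}$ at which $f^n$ is defined. Let $\mathcal R$ be the set of all connected components of the sets $f^{-n}(\{y=0\})$, $n\ge0$, and $\mathcal L$ the set of all connected components of the sets $f^{n}(\{y=-x\})$, $n\ge 0$. A family of subsets of the plane is called a lamination of the plane by smooth curves if (i) each member is the image of a $C^\infty$ map $\gamma:\mathbb{R}\to\mathbb{R}^2$ with nowhere vanishing derivative that is a closed embedding; (ii) distinct members are disjoint; (iii) every point of the plane lies in an open set $U$ with a homeomorphism $\varphi:U\to(-1,1)^2$ such that for each member $C$ there is a set $T\subseteq(-1,1)$ with $\varphi(C\cap U)=(-1,1)\times T$. Then $\mathcal R$ and $\mathcal L$ are laminations of the plane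 by smooth curves, and each curve of $\mathcal R$ is transverse to each curve of $\mathcal L$: at every common point their tangent lines together span $\mathbb{R}^2$. Moreover: (a) The sets $f^{-n}(\{y=0\})$, $n\ge 0$, are pairwise disjoint, and so are the sets $f^{n}(\{y=-x\})$, $n\ge 0$. (b) On each connected set of parameters $t$ at which $f^{-n}(t,0)$ is defined, both coordinates of $f^{-n}(t,0)$ are strictly increasing in $t$, for $n\ge1$. On each connected set of parameters $t$ at which $f^{n}(t,-t)$ is defined, the first coordinate of $f^n(t,-t)$ is strictly increasing and the second strictly decreasing in $t$, for $n\ge0$. (c) Write $f^{-j}(t,0)=(x_j(t),y_j(t))$. For each $n\ge 0$ there is exactly one $t_n\in\mathbb{R}$ with $x_j(t_n)+y_j(t_n)>0$ for all $0\le j<n$ (so that $f^{-n}(t_n,0)$ is defined) and $x_n(t_n)=0$; and $y_n(t_n)\to\infty$ as $n\to\infty$. -/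

import Mathlib

open Set Filter Topology
open scoped ContDiff

noncomputable section

namespace HenonDevaney

/-- The formula `(x, y) ↦ (x + 1/y, y - 1/y - x)` of the Hénon-Devaney map. The map itself is
defined only where `y ≠ 0`; every use below carries that condition. -/
def hd (p : ℝ × ℝ) : ℝ × ℝ := (p.1 + 1 / p.2, p.2 - 1 / p.2 - p.1)

/-- The formula `(x, y) ↦ (x - 1/(x+y), x + y)` of the inverse map, which is defined only where
`x + y ≠ 0`. -/
def hdInv (p : ℝ × ℝ) : ℝ × ℝ := (p.1 - 1 / (p.1 + p.2), p.1 + p.2)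

/-- `hd` maps `{y ≠ 0}` into `{x + y ≠ 0}`, and `hdInv` undoes it. -/
theorem hdInv_hd (p : ℝ × ℝ) (hp : p.2 ≠ 0) :
    (hd p).1 + (hd p).2 ≠ 0 ∧ hdInv (hd p) = p := by
  have h : (hd p).1 + (hd p).2 = p.2 := by simp only [hd]; ring
  refine ⟨by rw [h]; exact hp, ?_⟩
  unfold hdInv
  rw [h]
  ext <;> simp [hd]

/-- `hdInv` maps `{x + y ≠ 0}` into `{y ≠ 0}`, and `hd` undoes it. -/
theorem hd_hdInv (p : ℝ × ℝ) (hp : p.1 + p.2 ≠ 0) :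
    (hdInv p).2 ≠ 0 ∧ hd (hdInv p) = p := by
  refine ⟨hp, ?_⟩
  ext <;> simp [hd, hdInv]

/-- The set `f⁻ⁿ({y = 0})`: the points at which `fⁿ` is defined and takes a value in
`{y = 0}`. -/
def preAxis : ℕ → Set (ℝ × ℝ)
  | 0 => {p | p.2 = 0}
  | n + 1 => {p | p.2 ≠ 0 ∧ hd p ∈ preAxis n}

/-- The set `fⁿ({y = -x})`: the values of `fⁿ` at the points of `{y = -x}` at which it is
defined. -/
def imgAnti : ℕ → Set (ℝ × ℝ)
  | 0 => {p | p.2 = -p.1}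
  | n + 1 => hd '' {p | p ∈ imgAnti n ∧ p.2 ≠ 0}

/-- The curves that make up the sets `S n`: all connected components of all of these sets. -/
def curvesOf (S : ℕ → Set (ℝ × ℝ)) : Set (Set (ℝ × ℝ)) :=
  {C | ∃ n, ∃ p ∈ S n, C = connectedComponentIn (S n) p}

/-- A smooth, properly embedded curve in the plane: the image of a regular smooth map `ℝ → ℝ²`
that is a closed embedding. -/
def IsSmoothLine (C : Set (ℝ × ℝ)) : Prop :=
  ∃ γ : ℝ → ℝ × ℝ, ContDiff ℝ ∞ γ ∧ (∀ t, deriv γ t ≠ 0) ∧ IsClosedEmbedding γ ∧ range γ = C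

/-- A family of curves is a lamination of the plane by smooth lines: the curves (leaves) are
smooth and properly embedded, distinct ones are disjoint, and around every point of the plane
there is a flow box, that is, a chart onto a square which takes the part of each leaf in its
domain onto a union of full horizontal segments (plaques). -/
structure IsLamination (F : Set (Set (ℝ × ℝ))) : Prop where
  smooth : ∀ C ∈ F, IsSmoothLine C
  disjoint : F.PairwiseDisjoint id
  flowBox : ∀ p : ℝ × ℝ, ∃ φ : OpenPartialHomeomorph (ℝ × ℝ) (ℝ × ℝ),
    p ∈ φ.source ∧ φ.target = Ioo (-1 : ℝ) 1 ×ˢ Ioo (-1 : ℝ) 1 ∧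
      ∀ C ∈ F, ∃ T : Set ℝ, φ '' (C ∩ φ.source) = Ioo (-1 : ℝ) 1 ×ˢ T

/-- The tangent vectors of a curve `C` at `p`: the velocities at `p` of paths that run in `C`. -/
def tangentVectors (C : Set (ℝ × ℝ)) (p : ℝ × ℝ) : Set (ℝ × ℝ) :=
  {v | ∃ γ : ℝ → ℝ × ℝ, (∀ t, γ t ∈ C) ∧ γ 0 = p ∧ HasDerivAt γ v 0}

/-- Two curves are transverse: at each common point their tangent spaces together span the
plane. -/
def Transverse (C D : Set (ℝ × ℝ)) : Prop :=
  ∀ p ∈ C ∩ D, Submodule.span ℝ (tangentVectors C p ∪ tangentVectors D p) = ⊤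

/-- The parameters `t` at which `f⁻ⁿ(t, 0)` is defined. -/
def preDomain (n : ℕ) : Set ℝ :=
  {t | ∀ j < n, (hdInv^[j] (t, 0)).1 + (hdInv^[j] (t, 0)).2 ≠ 0}

/-- The parameters `t` at which `fⁿ(t, -t)` is defined. -/
def imgDomain (n : ℕ) : Set ℝ :=
  {t | ∀ j < n, (hd^[j] (t, -t)).2 ≠ 0}

end HenonDevaney

end

/-!
If `g` is nondecreasing, then so is the function whose graph is the part of `f⁻¹(graph g)` in the
upper half plane. Iterating this graph transform from the `x`-axis, together with the symmetry
`p ↦ -p`, shows that the components of `f⁻ⁿ({y = 0})` are graphs of smooth nondecreasing functions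
over the whole `x`-axis. Their union over all `n` is dense on every vertical line: every orbit
that never lands on `{y = 0}` keeps crossing this line in both directions. If a vertical segment
missed all preimages of `{y = 0}`, the orbits of its endpoints would stay on the same side of the
line at all times, while the gap between their heights grew linearly. At a late crossing the upper
orbit is then so far to the right that going back along it one never reaches the starting point.

A family of disjoint graphs which is dense on vertical lines has a continuous holonomy, and
sliding every point along its leaf to a fixed vertical line straightens the family globally.

The linear involution `(x, y) ↦ (x, -x - y)` conjugates `f` to `f⁻¹` and takes the first family
to the second, whose members are thus graphs with slope at most `-1`, hence transverse to the
nondecreasing graphs of the first. The highest component of each order lies above all others of that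
order, so density drives its height on the `y`-axis to infinity.
-/

namespace HenonDevaney

section Orbits

theorem one_div_lt_one_div_of_mul_pos {K : Type*} [Field K] [LinearOrder K]
    [IsStrictOrderedRing K] {a b : K} (hab : 0 < a * b) (hlt : a < b) : 1 / b < 1 / a := by
  rcases pos_and_pos_or_neg_and_neg_of_mul_pos hab with ⟨ha, -⟩ | ⟨-, hb⟩
  · exact one_div_lt_one_div_of_lt ha hlt
  · exact one_div_lt_one_div_of_neg_of_lt hb hlt

variable {p q : ℝ × ℝ}

theorem fst_add_snd_hd (p : ℝ × ℝ) : (hd p).1 + (hd p).2 = p.2 := by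
  simp only [hd]
  ring

theorem continuousOn_hd : ContinuousOn hd {p | p.2 ≠ 0} := by
  have h : ContinuousOn (fun p : ℝ × ℝ => 1 / p.2) {p | p.2 ≠ 0} :=
    continuousOn_const.div continuousOn_snd fun _ hp => hp
  exact (continuousOn_fst.add h).prodMk ((continuousOn_snd.sub h).sub continuousOn_fst)

theorem continuousOn_hdInv : ContinuousOn hdInv {p | p.1 + p.2 ≠ 0} := by
  have hadd : ContinuousOn (fun p : ℝ × ℝ => p.1 + p.2) {p | p.1 + p.2 ≠ 0} := by fun_prop
  exact (continuousOn_fst.sub (continuousOn_const.div hadd fun _ hp => hp)).prodMk hadd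

theorem continuousOn_iterate_hd (n : ℕ) :
    ContinuousOn hd^[n] {p | ∀ j < n, (hd^[j] p).2 ≠ 0} := by
  induction n with
  | zero => exact continuousOn_id
  | succ n ih =>
    rw [Function.iterate_succ']
    exact continuousOn_hd.comp (ih.mono fun p hp j hj => hp j (hj.trans n.lt_succ_self))
      fun p hp => hp n n.lt_succ_self

theorem hd_neg (p : ℝ × ℝ) : hd (-p) = -hd p := by
  ext <;> simp only [hd, Prod.fst_neg, Prod.snd_neg, div_neg] <;> ring

theorem iterate_hd_neg (n : ℕ) (p : ℝ × ℝ) : hd^[n] (-p) = -hd^[n] p :=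
  ((show Function.Commute hd Neg.neg from hd_neg).iterate_left n) p

theorem iterate_hd_iterate_hdInv {n : ℕ}
    (hp : ∀ j < n, (hdInv^[j] p).1 + (hdInv^[j] p).2 ≠ 0) : hd^[n] (hdInv^[n] p) = p := by
  induction n with
  | zero => rfl
  | succ n ih =>
    rw [Function.iterate_succ_apply' hdInv, Function.iterate_succ_apply hd,
      (hd_hdInv _ (hp n n.lt_succ_self)).2]
    exact ih fun j hj => hp j (hj.trans n.lt_succ_self)

theorem fst_iterate_hd_succ (n : ℕ) (p : ℝ × ℝ) :
    (hd^[n + 1] p).1 = (hd^[n] p).1 + 1 / (hd^[n] p).2 := by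
  rw [Function.iterate_succ_apply', hd]

theorem snd_iterate_hd_succ (n : ℕ) (p : ℝ × ℝ) :
    (hd^[n + 1] p).2 = (hd^[n] p).2 - (hd^[n + 1] p).1 := by
  rw [Function.iterate_succ_apply', ← fst_add_snd_hd (hd^[n] p), add_sub_cancel_left]

theorem monotone_fst_iterate_hd (hp : ∀ n, 0 < (hd^[n] p).2) :
    Monotone fun n => (hd^[n] p).1 :=
  monotone_nat_of_le_succ fun n => by
    rw [fst_iterate_hd_succ]
    exact le_add_of_nonneg_right (one_div_pos.2 (hp n)).le

theorem snd_iterate_hd_le (hp : ∀ n, 0 < (hd^[n] p).2) (n : ℕ) :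
    (hd^[n] p).2 ≤ p.2 - n * p.1 := by
  induction n with
  | zero => simp
  | succ n ih =>
    have hmono : p.1 ≤ (hd^[n + 1] p).1 := monotone_fst_iterate_hd hp (Nat.zero_le _)
    rw [snd_iterate_hd_succ]
    push_cast
    linarith

theorem fst_nonpos_of_forall_pos (hp : ∀ n, 0 < (hd^[n] p).2) : p.1 ≤ 0 := by
  by_contra! hpos
  obtain ⟨n, hn⟩ := exists_nat_gt (p.2 / p.1)
  rw [div_lt_iff₀ hpos] at hn
  linarith [hp n, snd_iterate_hd_le hp n]

theorem exists_snd_iterate_hd_nonpos (p : ℝ × ℝ) : ∃ n, (hd^[n] p).2 ≤ 0 := by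
  by_contra! hp
  have hfst (n : ℕ) : (hd^[n] p).1 ≤ 0 := fst_nonpos_of_forall_pos fun k => by
    simpa only [Function.iterate_add_apply] using hp (k + n)
  have hsum : Summable fun n => 1 / (hd^[n] p).2 := by
    refine summable_of_sum_range_le (c := -p.1) (fun n => (one_div_pos.2 (hp n)).le) fun n => ?_
    have htel : ∑ i ∈ Finset.range n, 1 / (hd^[i] p).2 = (hd^[n] p).1 - p.1 :=
      (Finset.sum_congr rfl fun i _ => by rw [fst_iterate_hd_succ, add_sub_cancel_left]).trans
        (Finset.sum_range_sub (fun i => (hd^[i] p).1) n)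
    linarith [hfst n]
  have h0 : p.1 ≤ 0 := hfst 0
  have h0' : 0 < p.2 := hp 0
  have hlin (n : ℕ) : (hd^[n] p).2 ≤ (p.2 - p.1) * ((n + 1 : ℕ) : ℝ) := by
    push_cast
    nlinarith [snd_iterate_hd_le hp n, mul_nonneg n.cast_nonneg h0'.le]
  have hharm : Summable fun n : ℕ => 1 / ((n + 1 : ℕ) : ℝ) := by
    refine Summable.of_nonneg_of_le (fun n => by positivity) (fun n => ?_)
      (hsum.mul_left (p.2 - p.1))
    rw [mul_one_div, div_le_div_iff₀ (by positivity) (hp n), one_mul]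
    exact hlin n
  exact Real.not_summable_one_div_natCast ((summable_nat_add_iff 1).1 hharm)

theorem exists_snd_iterate_hd_nonneg (p : ℝ × ℝ) : ∃ n, 0 ≤ (hd^[n] p).2 := by
  simpa only [iterate_hd_neg, Prod.snd_neg, neg_nonpos] using exists_snd_iterate_hd_nonpos (-p)

theorem exists_downcrossing (hp : ∀ n, (hd^[n] p).2 ≠ 0) (N : ℕ) :
    ∃ n ≥ N, 0 < (hd^[n] p).2 ∧ (hd^[n + 1] p).2 < 0 := by
  obtain ⟨m, hm⟩ := exists_snd_iterate_hd_nonneg (hd^[N] p)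
  rw [← Function.iterate_add_apply] at hm
  by_contra! hstay
  have hpos (k : ℕ) : 0 < (hd^[k + (m + N)] p).2 := by
    induction k with
    | zero => simpa only [zero_add] using hm.lt_of_ne' (hp _)
    | succ k ih =>
      have hnext := (hstay (k + (m + N)) (by omega) ih).lt_of_ne' (hp _)
      rwa [add_right_comm] at hnext
  obtain ⟨k, hk⟩ := exists_snd_iterate_hd_nonpos (hd^[m + N] p)
  rw [← Function.iterate_add_apply] at hk
  exact (hpos k).not_ge hk

-- Going back along the orbit, `y` is at least `c` as long as `x` is, so each step costs `x` at
-- most `1 / c`.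
theorem le_fst_of_le_fst_iterate_hd {c d : ℝ} (hc : 0 < c) (hcd : c ≤ d) {n : ℕ}
    (hy : 0 < (hd^[n] p).2) (hx : d + n / c ≤ (hd^[n] p).1) : d ≤ p.1 ∧ 0 < p.2 := by
  induction n generalizing p d with
  | zero => exact ⟨by simpa using hx, hy⟩
  | succ n ih =>
    have hc' : 0 < 1 / c := one_div_pos.2 hc
    have hx' : d + 1 / c + n / c ≤ (hd^[n] (hd p)).1 := by
      refine le_of_eq_of_le ?_ hx
      push_cast
      ring
    obtain ⟨hfst, hsnd⟩ := ih (by linarith) hy hx'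
    have hcy : c ≤ p.2 := by linarith [fst_add_snd_hd p]
    have hinv : 1 / p.2 ≤ 1 / c := one_div_le_one_div_of_le hc hcy
    have hhd : (hd p).1 = p.1 + 1 / p.2 := rfl
    exact ⟨by linarith, hc.trans_le hcy⟩

theorem fst_sub_fst_lt_hd (hs : 0 < p.2 * q.2) (hlt : q.2 < p.2) :
    q.1 - p.1 < (hd q).1 - (hd p).1 := by
  have hinv : 1 / p.2 < 1 / q.2 := one_div_lt_one_div_of_mul_pos (by rwa [mul_comm]) hlt
  simp only [hd]
  linarith

theorem exists_nat_mul_lt_snd_sub_snd (hfst : p.1 = q.1) (hlt : q.2 < p.2)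
    (hs : ∀ n, 0 < (hd^[n] p).2 * (hd^[n] q).2) :
    ∃ α > 0, ∀ n : ℕ, n * α < (hd^[n] p).2 - (hd^[n] q).2 := by
  have hstep (n : ℕ) (h : (hd^[n] q).2 < (hd^[n] p).2) :
      (hd^[n] q).1 - (hd^[n] p).1 < (hd^[n + 1] q).1 - (hd^[n + 1] p).1 := by
    simpa only [Function.iterate_succ_apply'] using fst_sub_fst_lt_hd (hs n) h
  have hα : 0 < (hd q).1 - (hd p).1 := by simpa [hfst] using hstep 0 hlt
  refine ⟨_, hα, fun n => ?_⟩
  suffices n * ((hd q).1 - (hd p).1) < (hd^[n] p).2 - (hd^[n] q).2 ∧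
      (hd q).1 - (hd p).1 ≤ (hd^[n + 1] q).1 - (hd^[n + 1] p).1 from this.1
  induction n with
  | zero => exact ⟨by simpa using hlt, le_rfl⟩
  | succ n ih =>
    have hgap : ((n + 1 : ℕ) : ℝ) * ((hd q).1 - (hd p).1) <
        (hd^[n + 1] p).2 - (hd^[n + 1] q).2 := by
      rw [snd_iterate_hd_succ, snd_iterate_hd_succ]
      push_cast
      linarith [ih.1, ih.2]
    have hlt' : (hd^[n + 1] q).2 < (hd^[n + 1] p).2 :=
      sub_pos.1 (lt_of_le_of_lt (by positivity) hgap)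
    exact ⟨hgap, ih.2.trans (hstep _ hlt').le⟩

theorem exists_snd_iterate_hd_mul_nonpos (hfst : p.1 = q.1) (hlt : q.2 < p.2) :
    ∃ n, (hd^[n] p).2 * (hd^[n] q).2 ≤ 0 := by
  by_contra! hs
  obtain ⟨α, hα, hgap⟩ := exists_nat_mul_lt_snd_sub_snd hfst hlt hs
  set c := |p.1| + 1 + 2 / α
  have hαc : 2 / α < c := lt_add_of_pos_left _ (by positivity)
  have hc : 0 < c := lt_trans (by positivity) hαc
  have hpc : p.1 < c := by
    have : 0 < 2 / α := by positivity
    linarith [le_abs_self p.1]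
  obtain ⟨N, hN⟩ := exists_nat_gt (2 * (c + 1) / α)
  obtain ⟨n, hNn, hpn, hpn'⟩ := exists_downcrossing (fun n => left_ne_zero_of_mul (hs n).ne') N
  have hqn : 0 < (hd^[n] q).2 := pos_of_mul_pos_right (hs n) hpn.le
  have hnα : 2 * (c + 1) < n * α := by
    rw [← div_lt_iff₀ hα]
    exact hN.trans_le (Nat.cast_le.2 hNn)
  have hinv : 1 / (hd^[n] p).2 ≤ 1 := (div_le_one hpn).2 (by linarith [hgap n])
  have hnc : n / c ≤ n * α / 2 := by
    rw [div_lt_iff₀ hα] at hαc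
    rw [div_le_div_iff₀ hc two_pos]
    nlinarith [mul_le_mul_of_nonneg_left hαc.le n.cast_nonneg]
  have hxn : c + n / c ≤ (hd^[n] p).1 := by
    linarith [hgap n, fst_iterate_hd_succ n p, snd_iterate_hd_succ n p]
  exact hpc.not_ge (le_fst_of_le_fst_iterate_hd hc le_rfl hpn hxn).1

end Orbits

section GraphTransform

variable {g : ℝ → ℝ} {p q : ℝ × ℝ}

theorem contDiffAt_of_eventually_eq_imp {𝕜 E : Type*} [RCLike 𝕜] [NormedAddCommGroup E]
    [NormedSpace 𝕜 E] [CompleteSpace E] {f : E × 𝕜 → 𝕜} {u : E → 𝕜} {x : E} {c : 𝕜}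
    {n : ℕ∞ω} (hn : n ≠ 0) (hf : ContDiffAt 𝕜 n f (x, u x))
    (hfc : HasDerivAt (fun y => f (x, y)) c (u x)) (hc : c ≠ 0)
    (hu : ∀ᶠ v in 𝓝 (x, u x), f v = f (x, u x) → v.2 = u v.1) : ContDiffAt 𝕜 n u x := by
  have hpartial : fderiv 𝕜 f (x, u x) (0, 1) = c :=
    ((hf.differentiableAt hn).hasFDerivAt.comp_hasDerivAt (u x)
      ((hasDerivAt_const (u x) x).prodMk (hasDerivAt_id (u x)))).unique hfc
  have hinv : (fderiv 𝕜 f (x, u x) ∘L .inr 𝕜 E 𝕜).IsInvertible := by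
    refine ⟨ContinuousLinearEquiv.unitsEquivAut 𝕜 (Units.mk0 c hc), ?_⟩
    ext
    simp [hpartial]
  have hψ := hf.contDiffAt_implicitFunction hn hinv
  have hlim : Tendsto (fun x' => (x', hf.implicitFunction hn hinv x')) (𝓝 x) (𝓝 (x, u x)) := by
    have hψx : hf.implicitFunction hn hinv x = u x := hf.implicitFunction_apply_self hn hinv
    simpa only [ContinuousAt, hψx, id] using continuousAt_id.prodMk hψ.continuousAt
  refine hψ.congr_of_eventuallyEq ?_
  filter_upwards [hlim.eventually hu, hf.eventually_apply_implicitFunction hn hinv]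
    with x' hx' heq
  exact (hx' heq).symm

theorem mem_graphOn_univ {X Y : Type*} {f : X → Y} {z : X × Y} :
    z ∈ univ.graphOn f ↔ f z.1 = z.2 := by simp

theorem exists_pos_hd_mem_graphOn (hc : Continuous g) (hm : Monotone g) (x : ℝ) :
    ∃ y, 0 < y ∧ hd (x, y) ∈ univ.graphOn g := by
  set M : ℝ := 1 + |x + g (x + 1)|
  have hM : 1 ≤ M := le_add_of_nonneg_right (abs_nonneg _)
  have hM0 : 0 < M := one_pos.trans_le hM
  have hM' : 1 / M ≤ 1 := (div_le_one hM0).2 hM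
  have hpos : ∀ y ∈ Icc (1 / M) M, 0 < y := fun y hy => (one_div_pos.2 hM0).trans_le hy.1
  have hhd : ContinuousOn (fun y => hd (x, y)) (Icc (1 / M) M) :=
    continuousOn_hd.comp (by fun_prop) fun y hy => (hpos y hy).ne'
  have hcont : ContinuousOn (fun y => (hd (x, y)).2 - g (hd (x, y)).1) (Icc (1 / M) M) :=
    hhd.snd.sub (hc.comp_continuousOn hhd.fst)
  have hlo : (hd (x, 1 / M)).2 - g (hd (x, 1 / M)).1 ≤ 0 := by
    have hg : g (x + 1) ≤ g (x + M) := hm (by linarith)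
    simp only [hd, one_div_one_div]
    linarith [neg_abs_le (x + g (x + 1))]
  have hhi : 0 ≤ (hd (x, M)).2 - g (hd (x, M)).1 := by
    have hg : g (x + 1 / M) ≤ g (x + 1) := hm (by linarith)
    simp only [hd]
    linarith [le_abs_self (x + g (x + 1))]
  obtain ⟨y, hy, hy0⟩ := intermediate_value_Icc (hM'.trans hM) hcont ⟨hlo, hhi⟩
  exact ⟨y, hpos y hy, mem_graphOn_univ.2 (sub_eq_zero.1 hy0).symm⟩

theorem snd_le_snd_of_hd (hm : Monotone g) (hfst : p.1 ≤ q.1) (hq : 0 < q.2)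
    (hp_le : (hd p).2 ≤ g (hd p).1) (hq_ge : g (hd q).1 ≤ (hd q).2) : p.2 ≤ q.2 := by
  by_contra! hlt
  have hinv : 1 / p.2 < 1 / q.2 := one_div_lt_one_div_of_lt hq hlt
  have hg : g (hd p).1 ≤ g (hd q).1 := hm (by simp only [hd]; linarith)
  simp only [hd] at hp_le hq_ge hg
  linarith

/-- The graph transform: for continuous monotone `g`, the function whose graph is the part in
the upper half plane of the preimage under `hd` of the graph of `g`. -/
noncomputable def upperBranch (g : ℝ → ℝ) (x : ℝ) : ℝ :=
  Classical.epsilon fun y => 0 < y ∧ hd (x, y) ∈ univ.graphOn g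

theorem upperBranch_spec (hc : Continuous g) (hm : Monotone g) (x : ℝ) :
    0 < upperBranch g x ∧ hd (x, upperBranch g x) ∈ univ.graphOn g :=
  Classical.epsilon_spec (exists_pos_hd_mem_graphOn hc hm x)

theorem snd_le_upperBranch (hc : Continuous g) (hm : Monotone g)
    (hp : (hd p).2 ≤ g (hd p).1) {x : ℝ} (hx : p.1 ≤ x) : p.2 ≤ upperBranch g x := by
  obtain ⟨hpos, hmem⟩ := upperBranch_spec hc hm x
  exact snd_le_snd_of_hd hm (q := (x, upperBranch g x)) hx hpos hp (mem_graphOn_univ.1 hmem).le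

theorem monotone_upperBranch (hc : Continuous g) (hm : Monotone g) :
    Monotone (upperBranch g) := fun x _ hx =>
  snd_le_upperBranch hc hm (p := (x, upperBranch g x))
    (mem_graphOn_univ.1 (upperBranch_spec hc hm x).2).ge hx

theorem mem_graphOn_upperBranch (hc : Continuous g) (hm : Monotone g) :
    p ∈ univ.graphOn (upperBranch g) ↔ 0 < p.2 ∧ hd p ∈ univ.graphOn g := by
  obtain ⟨hpos, hmem⟩ := upperBranch_spec hc hm p.1
  refine mem_graphOn_univ.trans ⟨fun h => ?_, fun ⟨hp, hpg⟩ => ?_⟩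
  · rw [h] at hpos hmem
    exact ⟨hpos, hmem⟩
  · rw [mem_graphOn_univ] at hpg
    exact (snd_le_snd_of_hd hm (p := (p.1, upperBranch g p.1)) (q := p) le_rfl hp
      (mem_graphOn_univ.1 hmem).ge hpg.le).antisymm (snd_le_upperBranch hc hm hpg.ge le_rfl)

theorem contDiff_upperBranch {n : ℕ∞ω} (hn : n ≠ 0) (hg : ContDiff ℝ n g) (hm : Monotone g) :
    ContDiff ℝ n (upperBranch g) := by
  refine contDiff_iff_contDiffAt.2 fun x => ?_
  obtain ⟨hpos, hmem⟩ := upperBranch_spec hg.continuous hm x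
  set y := upperBranch g x
  have hinv : HasDerivAt (fun y : ℝ => 1 / y) (-(y ^ 2)⁻¹) y := by
    simpa using hasDerivAt_inv hpos.ne'
  have hgd : HasDerivAt g (deriv g (x + 1 / y)) (x + 1 / y) :=
    (hg.differentiable hn _).hasDerivAt
  refine contDiffAt_of_eventually_eq_imp (f := fun v => (hd v).2 - g (hd v).1) hn ?_
    ((((hasDerivAt_id y).sub hinv).sub_const x).sub (hgd.comp y (hinv.const_add x))) ?_ ?_
  · have hinv' : ContDiffAt ℝ n (fun v : ℝ × ℝ => 1 / v.2) (x, y) :=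
      contDiffAt_const.div contDiffAt_snd hpos.ne'
    exact ((contDiffAt_snd.sub hinv').sub contDiffAt_fst).sub
      (hg.contDiffAt.comp _ (contDiffAt_fst.add hinv'))
  · have hslope : 0 ≤ deriv g (x + 1 / y) * (y ^ 2)⁻¹ :=
      mul_nonneg hm.deriv_nonneg (by positivity)
    have hy2 : 0 < (y ^ 2)⁻¹ := by positivity
    exact ne_of_gt (by linarith)
  · filter_upwards [continuousAt_snd.eventually (lt_mem_nhds hpos)] with v hv heq
    rw [mem_graphOn_univ.1 hmem, sub_self, sub_eq_zero] at heq
    exact (mem_graphOn_univ.1 ((mem_graphOn_upperBranch hg.continuous hm).2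
      ⟨hv, mem_graphOn_univ.2 heq.symm⟩)).symm

end GraphTransform

section DenseGraphFamily

variable {X Y : Type*} [TopologicalSpace X] [TopologicalSpace Y]

/-- A family of continuous functions whose graphs are pairwise disjoint and meet every open
vertical segment, so that their closure foliates `X × Y`. -/
structure IsDenseGraphFamily [Preorder Y] (G : Set (X → Y)) : Prop where
  continuous : ∀ g ∈ G, Continuous g
  eq_of_apply_eq : ∀ g ∈ G, ∀ h ∈ G, ∀ x, g x = h x → g = h
  dense : ∀ x y y', y < y' → ∃ g ∈ G, y < g x ∧ g x < y'

/-- The holonomy of the foliation that a dense graph family generates: the height over `b` of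
the leaf which passes at height `y` over `a`. -/
noncomputable def transport {X Y : Type*} [LE Y] [SupSet Y] (G : Set (X → Y)) (a b : X)
    (y : Y) : Y :=
  sSup {z | ∃ g ∈ G, g a ≤ y ∧ g b = z}

namespace IsDenseGraphFamily

theorem lt_of_lt [PreconnectedSpace X] [LinearOrder Y] [OrderClosedTopology Y]
    {G : Set (X → Y)} (hG : IsDenseGraphFamily G) {g h : X → Y} (hg : g ∈ G) (hh : h ∈ G)
    {x : X} (x' : X) (hlt : g x < h x) : g x' < h x' := by
  by_contra! hle
  obtain ⟨z, hz⟩ :=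
    intermediate_value_univ₂ (hG.continuous g hg) (hG.continuous h hh) hlt.le hle
  rw [hG.eq_of_apply_eq g hg h hh z hz] at hlt
  exact hlt.false

theorem le_of_le [PreconnectedSpace X] [LinearOrder Y] [OrderClosedTopology Y]
    {G : Set (X → Y)} (hG : IsDenseGraphFamily G) {g h : X → Y} (hg : g ∈ G) (hh : h ∈ G)
    {x : X} (x' : X) (hle : g x ≤ h x) : g x' ≤ h x' :=
  le_of_not_gt fun hlt => hle.not_gt (hG.lt_of_lt hh hg x hlt)

variable [PreconnectedSpace X] [ConditionallyCompleteLinearOrder Y] [OrderTopology Y]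
  {G : Set (X → Y)} {g : X → Y} {a b : X} {y : Y}

theorem le_transport [NoMaxOrder Y] (hG : IsDenseGraphFamily G) (hg : g ∈ G) (hy : g a ≤ y) :
    g b ≤ transport G a b y := by
  obtain ⟨y', hyy'⟩ := exists_gt y
  obtain ⟨k, hk, hyk, -⟩ := hG.dense a y y' hyy'
  refine le_csSup ⟨k b, ?_⟩ ⟨g, hg, hy, rfl⟩
  rintro _ ⟨l, hl, hly, rfl⟩
  exact hG.le_of_le hl hk b (hly.trans hyk.le)

theorem transport_le [NoMinOrder Y] (hG : IsDenseGraphFamily G) (hg : g ∈ G) (hy : y ≤ g a) :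
    transport G a b y ≤ g b := by
  obtain ⟨y', hyy'⟩ := exists_lt y
  obtain ⟨k, hk, -, hky⟩ := hG.dense a y' y hyy'
  refine csSup_le ⟨k b, k, hk, hky.le, rfl⟩ ?_
  rintro _ ⟨l, hl, hly, rfl⟩
  exact hG.le_of_le hl hg b (hly.trans hy)

variable [NoMaxOrder Y] [NoMinOrder Y]

theorem lt_transport_iff (hG : IsDenseGraphFamily G) (hg : g ∈ G) :
    g b < transport G a b y ↔ g a < y := by
  refine ⟨fun h => lt_of_not_ge fun hy => h.not_ge (hG.transport_le hg hy), fun h => ?_⟩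
  obtain ⟨k, hk, hgk, hky⟩ := hG.dense a _ _ h
  exact (hG.lt_of_lt hg hk b hgk).trans_le (hG.le_transport hk hky.le)

theorem transport_lt_iff (hG : IsDenseGraphFamily G) (hg : g ∈ G) :
    transport G a b y < g b ↔ y < g a := by
  refine ⟨fun h => lt_of_not_ge fun hy => h.not_ge (hG.le_transport hg hy), fun h => ?_⟩
  obtain ⟨k, hk, hyk, hkg⟩ := hG.dense a _ _ h
  exact (hG.transport_le hk hyk.le).trans_lt (hG.lt_of_lt hk hg b hkg)

theorem transport_apply (hG : IsDenseGraphFamily G) (hg : g ∈ G) (a b : X) :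
    transport G a b (g a) = g b :=
  (hG.transport_le hg le_rfl).antisymm (hG.le_transport hg le_rfl)

theorem transport_transport (hG : IsDenseGraphFamily G) (a b : X) (y : Y) :
    transport G b a (transport G a b y) = y := by
  refine le_antisymm (le_of_not_gt fun h => ?_) (le_of_not_gt fun h => ?_) <;>
    obtain ⟨g, hg, hlt, hlt'⟩ := hG.dense a _ _ h
  · rw [hG.lt_transport_iff hg, hG.lt_transport_iff hg] at hlt'
    exact hlt.not_gt hlt'
  · rw [hG.transport_lt_iff hg, hG.transport_lt_iff hg] at hlt
    exact hlt.not_gt hlt'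

theorem continuous_transport (hG : IsDenseGraphFamily G) :
    Continuous fun q : X × X × Y => transport G q.1 q.2.1 q.2.2 := by
  refine continuous_iff_continuousAt.2 fun ⟨a, b, y⟩ => tendsto_order.2
    ⟨fun l hl => ?_, fun u hu => ?_⟩
  · obtain ⟨g, hg, hlg, hgt⟩ := hG.dense b _ _ hl
    have hc := hG.continuous g hg
    have hy : ∀ᶠ q : X × X × Y in 𝓝 (a, b, y), g q.1 < q.2.2 :=
      (isOpen_lt (by fun_prop) (by fun_prop)).mem_nhds ((hG.lt_transport_iff hg).1 hgt)
    have hl : ∀ᶠ q : X × X × Y in 𝓝 (a, b, y), l < g q.2.1 :=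
      (isOpen_lt (by fun_prop) (by fun_prop)).mem_nhds hlg
    filter_upwards [hy, hl] with q hqy hql
    exact hql.trans ((hG.lt_transport_iff hg).2 hqy)
  · obtain ⟨g, hg, htg, hgu⟩ := hG.dense b _ _ hu
    have hc := hG.continuous g hg
    have hy : ∀ᶠ q : X × X × Y in 𝓝 (a, b, y), q.2.2 < g q.1 :=
      (isOpen_lt (by fun_prop) (by fun_prop)).mem_nhds ((hG.transport_lt_iff hg).1 htg)
    have hu : ∀ᶠ q : X × X × Y in 𝓝 (a, b, y), g q.2.1 < u :=
      (isOpen_lt (by fun_prop) (by fun_prop)).mem_nhds hgu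
    filter_upwards [hy, hu] with q hqy hqu
    exact ((hG.transport_lt_iff hg).2 hqy).trans hqu

/-- The homeomorphism which slides each point along its leaf to the fibre over `a`, and thereby
takes the graphs of the family to horizontal lines. -/
noncomputable def straighten (hG : IsDenseGraphFamily G) (a : X) : X × Y ≃ₜ X × Y where
  toFun p := (p.1, transport G p.1 a p.2)
  invFun p := (p.1, transport G a p.1 p.2)
  left_inv _ := Prod.ext rfl (hG.transport_transport _ _ _)
  right_inv _ := Prod.ext rfl (hG.transport_transport _ _ _)
  continuous_toFun := continuous_fst.prodMk (hG.continuous_transport.comp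
    (continuous_fst.prodMk (continuous_const.prodMk continuous_snd)))
  continuous_invFun := continuous_fst.prodMk (hG.continuous_transport.comp
    (continuous_const.prodMk (continuous_fst.prodMk continuous_snd)))

theorem straighten_image_graphOn (hG : IsDenseGraphFamily G) (a : X) (hg : g ∈ G) :
    hG.straighten a '' univ.graphOn g = univ ×ˢ {g a} := by
  rw [graphOn_univ_eq_range, ← range_comp, prod_singleton, image_univ]
  exact congrArg range (funext fun x => Prod.ext rfl (hG.transport_apply hg x a))

end IsDenseGraphFamily

theorem isSmoothLine_graphOn {g : ℝ → ℝ} (hg : ContDiff ℝ ∞ g) :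
    IsSmoothLine (univ.graphOn g) := by
  refine ⟨fun t => (t, g t), contDiff_id.prodMk hg, fun t => ?_,
    Function.LeftInverse.isClosedEmbedding (f := Prod.fst) (fun _ => rfl) continuous_fst
      (continuous_id.prodMk hg.continuous), graphOn_univ_eq_range.symm⟩
  have hderiv : HasDerivAt (fun t => (t, g t)) (1, deriv g t) t :=
    (hasDerivAt_id t).prodMk (hg.differentiable (by simp) t).hasDerivAt
  rw [hderiv.deriv]
  exact fun h => one_ne_zero (congrArg Prod.fst h)

theorem IsDenseGraphFamily.isLamination {G : Set (ℝ → ℝ)} (hG : IsDenseGraphFamily G)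
    (hs : ∀ g ∈ G, ContDiff ℝ ∞ g) : IsLamination ((univ.graphOn ·) '' G) where
  smooth := forall_mem_image.2 fun g hg => isSmoothLine_graphOn (hs g hg)
  disjoint := by
    rintro _ ⟨g, hg, rfl⟩ _ ⟨h, hh, rfl⟩ hne
    refine disjoint_left.2 fun p hpg hph => hne ?_
    rw [hG.eq_of_apply_eq g hg h hh p.1
      ((mem_graphOn_univ.1 hpg).trans (mem_graphOn_univ.1 hph).symm)]
  flowBox p := by
    obtain ⟨θ, hsource, htarget⟩ : ∃ θ : OpenPartialHomeomorph ℝ ℝ,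
        θ.source = univ ∧ θ.target = Ioo (-1) 1 :=
      ⟨.univUnitBall, OpenPartialHomeomorph.univUnitBall_source,
        OpenPartialHomeomorph.univUnitBall_target.trans (by simp [Real.ball_eq_Ioo])⟩
    have himage : θ '' univ = Ioo (-1) 1 := by
      rw [← htarget, ← θ.image_source_eq_target, hsource]
    refine ⟨(hG.straighten 0).transOpenPartialHomeomorph (θ.prod θ), by simp [hsource],
      by simp [htarget], forall_mem_image.2 fun g hg => ⟨{θ (g 0)}, ?_⟩⟩
    calc
      _ = Prod.map θ θ '' (hG.straighten 0 '' univ.graphOn g) := by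
        rw [image_image]
        simp [hsource, Prod.map]
      _ = Ioo (-1) 1 ×ˢ {θ (g 0)} := by
        rw [hG.straighten_image_graphOn 0 hg, prodMap_image_prod, himage, image_singleton]

end DenseGraphFamily

section Leaves

variable {m n : ℕ} {g h : ℝ → ℝ} {p : ℝ × ℝ}

theorem mem_preAxis_iff_iterate :
    p ∈ preAxis n ↔ (∀ j < n, (hd^[j] p).2 ≠ 0) ∧ (hd^[n] p).2 = 0 := by
  induction n generalizing p with
  | zero => exact ⟨fun h => ⟨fun _ hj => absurd hj (Nat.not_lt_zero _), h⟩, And.right⟩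
  | succ n ih =>
    change p.2 ≠ 0 ∧ hd p ∈ preAxis n ↔ _
    rw [ih, Nat.forall_lt_succ_left', and_assoc]
    rfl

theorem neg_mem_preAxis : -p ∈ preAxis n ↔ p ∈ preAxis n := by
  simp only [mem_preAxis_iff_iterate, iterate_hd_neg, Prod.snd_neg, neg_ne_zero, neg_eq_zero]

theorem disjoint_preAxis (hmn : m ≠ n) : Disjoint (preAxis m) (preAxis n) := by
  refine disjoint_left.2 fun p hm hn => ?_
  rw [mem_preAxis_iff_iterate] at hm hn
  rcases hmn.lt_or_gt with h | h
  · exact hn.1 m h hm.2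
  · exact hm.1 n h hn.2

theorem snd_iterate_hd_ne_zero (hp : ∀ n, p ∉ preAxis n) (n : ℕ) : (hd^[n] p).2 ≠ 0 := by
  induction n using Nat.strong_induction_on with
  | _ n ih => exact fun h0 => hp n (mem_preAxis_iff_iterate.2 ⟨ih, h0⟩)

theorem mul_pos_of_isPreconnected {X : Type*} [TopologicalSpace X] {K : Set X}
    (hK : IsPreconnected K) {f : X → ℝ} (hf : ContinuousOn f K) (hf0 : ∀ x ∈ K, f x ≠ 0)
    {x y : X} (hx : x ∈ K) (hy : y ∈ K) : 0 < f x * f y := by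
  by_contra! hle
  have h0 : 0 ∈ uIcc (f x) (f y) :=
    mem_uIcc.2 ((mul_nonpos_iff.1 hle).symm.imp id And.symm)
  obtain ⟨z, hz, hfz⟩ := (hK.image f hf).ordConnected.uIcc_subset (mem_image_of_mem f hx)
    (mem_image_of_mem f hy) h0
  exact hf0 z hz hfz

theorem exists_mem_preAxis (x : ℝ) {y y' : ℝ} (hlt : y < y') :
    ∃ z ∈ Icc y y', ∃ n, (x, z) ∈ preAxis n := by
  by_contra! hK
  have hne (n : ℕ) : ∀ z ∈ Icc y y', (hd^[n] (x, z)).2 ≠ 0 := fun z hz =>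
    snd_iterate_hd_ne_zero (hK z hz) n
  have hcont (n : ℕ) : ContinuousOn (fun z => (hd^[n] (x, z)).2) (Icc y y') :=
    ((continuousOn_iterate_hd n).comp (by fun_prop) fun z hz j _ => hne j z hz).snd
  obtain ⟨n, hn⟩ := exists_snd_iterate_hd_mul_nonpos (p := (x, y')) (q := (x, y)) rfl hlt
  exact hn.not_gt (mul_pos_of_isPreconnected isPreconnected_Icc (hcont n) (hne n)
    (right_mem_Icc.2 hlt.le) (left_mem_Icc.2 hlt.le))

/-- The functions whose graphs are the components of `preAxis n`. A branch below the axis is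
the image of a branch above it under the point reflection, which commutes with `hd`. -/
inductive IsLeaf : ℕ → (ℝ → ℝ) → Prop
  | axis : IsLeaf 0 fun _ => 0
  | upper {n : ℕ} {g : ℝ → ℝ} : IsLeaf n g → IsLeaf (n + 1) (upperBranch g)
  | reflect {n : ℕ} {g : ℝ → ℝ} : IsLeaf n g → IsLeaf n fun x => -g (-x)

theorem mem_graphOn_neg_comp_neg {X Y : Type*} [Neg X] [InvolutiveNeg Y] {f : X → Y}
    {z : X × Y} : z ∈ univ.graphOn (fun x => -f (-x)) ↔ -z ∈ univ.graphOn f := by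
  simp [neg_eq_iff_eq_neg]

namespace IsLeaf

theorem contDiff_and_monotone (hg : IsLeaf n g) : ContDiff ℝ ∞ g ∧ Monotone g := by
  induction hg with
  | axis => exact ⟨contDiff_const, monotone_const⟩
  | upper _ ih => exact ⟨contDiff_upperBranch (by simp) ih.1 ih.2,
      monotone_upperBranch ih.1.continuous ih.2⟩
  | reflect _ ih => exact ⟨(ih.1.comp contDiff_neg).neg,
      fun _ _ hxy => neg_le_neg (ih.2 (neg_le_neg hxy))⟩

theorem contDiff (hg : IsLeaf n g) : ContDiff ℝ ∞ g := hg.contDiff_and_monotone.1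

theorem continuous (hg : IsLeaf n g) : Continuous g := hg.contDiff.continuous

theorem monotone (hg : IsLeaf n g) : Monotone g := hg.contDiff_and_monotone.2

theorem mem_graphOn_upper (hg : IsLeaf n g) :
    p ∈ univ.graphOn (upperBranch g) ↔ 0 < p.2 ∧ hd p ∈ univ.graphOn g :=
  mem_graphOn_upperBranch hg.continuous hg.monotone

theorem graphOn_subset_preAxis (hg : IsLeaf n g) : univ.graphOn g ⊆ preAxis n := by
  induction hg with
  | axis => exact fun p hp => (mem_graphOn_univ.1 hp).symm
  | upper hg ih => exact fun p hp =>
      have hp' := hg.mem_graphOn_upper.1 hp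
      ⟨hp'.1.ne', ih hp'.2⟩
  | reflect _ ih => exact fun p hp => neg_mem_preAxis.1 (ih (mem_graphOn_neg_comp_neg.1 hp))

theorem subset_graphOn_of_isPreconnected (hg : IsLeaf n g) {K : Set (ℝ × ℝ)}
    (hK : IsPreconnected K) (hKn : K ⊆ preAxis n) (hp : p ∈ K) (hpg : p ∈ univ.graphOn g) :
    K ⊆ univ.graphOn g := by
  induction hg generalizing K p with
  | axis => exact fun q hq => mem_graphOn_univ.2 (hKn hq).symm
  | upper hg ih =>
    rw [hg.mem_graphOn_upper] at hpg
    have hne : ∀ q ∈ K, q.2 ≠ 0 := fun q hq => (hKn hq).1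
    have himage : hd '' K ⊆ univ.graphOn _ := ih (hK.image _ (continuousOn_hd.mono hne))
      (image_subset_iff.2 fun q hq => (hKn hq).2) (mem_image_of_mem _ hp) hpg.2
    exact fun q hq => hg.mem_graphOn_upper.2
      ⟨pos_of_mul_pos_right (mul_pos_of_isPreconnected hK continuousOn_snd hne hp hq) hpg.1.le,
        himage (mem_image_of_mem _ hq)⟩
  | reflect _ ih =>
    rw [mem_graphOn_neg_comp_neg] at hpg
    have himage := ih (hK.image Neg.neg continuousOn_neg)
      (image_subset_iff.2 fun q hq => neg_mem_preAxis.2 (hKn hq)) (mem_image_of_mem _ hp) hpg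
    exact fun q hq => mem_graphOn_neg_comp_neg.2 (himage (mem_image_of_mem _ hq))

theorem connectedComponentIn_eq (hg : IsLeaf n g) (hp : p ∈ univ.graphOn g) :
    connectedComponentIn (preAxis n) p = univ.graphOn g := by
  have hconn : IsPreconnected (univ.graphOn g) :=
    isPreconnected_univ.image _ (continuous_id.prodMk hg.continuous).continuousOn
  exact (hg.subset_graphOn_of_isPreconnected isPreconnected_connectedComponentIn
    (connectedComponentIn_subset _ _)
    (mem_connectedComponentIn (hg.graphOn_subset_preAxis hp)) hp).antisymm
    (hconn.subset_connectedComponentIn hp hg.graphOn_subset_preAxis)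

theorem eq_of_apply_eq (hg : IsLeaf m g) (hh : IsLeaf n h) {x : ℝ} (hx : g x = h x) :
    g = h := by
  have hpg : (x, g x) ∈ univ.graphOn g := mem_graphOn_univ.2 rfl
  have hph : (x, g x) ∈ univ.graphOn h := mem_graphOn_univ.2 hx.symm
  obtain rfl : m = n := by
    by_contra hmn
    exact disjoint_left.1 (disjoint_preAxis hmn) (hg.graphOn_subset_preAxis hpg)
      (hh.graphOn_subset_preAxis hph)
  rw [← graphOn_univ_inj, ← hg.connectedComponentIn_eq hpg, ← hh.connectedComponentIn_eq hph]

end IsLeaf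

theorem exists_isLeaf_of_mem_preAxis (hp : p ∈ preAxis n) :
    ∃ g, IsLeaf n g ∧ p ∈ univ.graphOn g := by
  induction n generalizing p with
  | zero => exact ⟨_, .axis, mem_graphOn_univ.2 hp.symm⟩
  | succ n ih =>
    have hpos {q : ℝ × ℝ} (hq : q ∈ preAxis (n + 1)) (hq0 : 0 < q.2) :
        ∃ g, IsLeaf (n + 1) g ∧ q ∈ univ.graphOn g := by
      obtain ⟨g, hg, hqg⟩ := ih hq.2
      exact ⟨_, .upper hg, hg.mem_graphOn_upper.2 ⟨hq0, hqg⟩⟩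
    rcases lt_or_gt_of_ne hp.1 with hneg | hp0
    · obtain ⟨g, hg, hpg⟩ := hpos (neg_mem_preAxis.2 hp) (neg_pos.2 hneg)
      exact ⟨_, .reflect hg, mem_graphOn_neg_comp_neg.2 hpg⟩
    · exact hpos hp hp0

theorem curvesOf_preAxis :
    curvesOf preAxis = (univ.graphOn ·) '' {g | ∃ n, IsLeaf n g} := by
  refine Subset.antisymm ?_ (image_subset_iff.2 ?_)
  · rintro _ ⟨n, p, hp, rfl⟩
    obtain ⟨g, hg, hpg⟩ := exists_isLeaf_of_mem_preAxis hp
    exact ⟨g, ⟨n, hg⟩, (hg.connectedComponentIn_eq hpg).symm⟩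
  · rintro g ⟨n, hg⟩
    have hp : (0, g 0) ∈ univ.graphOn g := mem_graphOn_univ.2 rfl
    exact ⟨n, _, hg.graphOn_subset_preAxis hp, (hg.connectedComponentIn_eq hp).symm⟩

theorem isDenseGraphFamily_isLeaf : IsDenseGraphFamily {g | ∃ n, IsLeaf n g} where
  continuous := fun _ ⟨_, hg⟩ => hg.continuous
  eq_of_apply_eq := fun _ ⟨_, hg⟩ _ ⟨_, hh⟩ _ hx => hg.eq_of_apply_eq hh hx
  dense x y y' hlt := by
    obtain ⟨z, hyz, hzy'⟩ := exists_between hlt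
    obtain ⟨z', hzz', hz'y'⟩ := exists_between hzy'
    obtain ⟨w, hw, n, hn⟩ := exists_mem_preAxis x hzz'
    obtain ⟨g, hg, hgw⟩ := exists_isLeaf_of_mem_preAxis hn
    obtain rfl : g x = w := mem_graphOn_univ.1 hgw
    exact ⟨g, ⟨n, hg⟩, hyz.trans_le hw.1, hw.2.trans_lt hz'y'⟩

theorem isLamination_preAxis : IsLamination (curvesOf preAxis) := by
  rw [curvesOf_preAxis]
  exact isDenseGraphFamily_isLeaf.isLamination fun _ ⟨_, hg⟩ => hg.contDiff

end Leaves

section Reversor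

variable {n : ℕ} {g h : ℝ → ℝ} {p : ℝ × ℝ}

/-- The linear involution that conjugates `hd` to `hdInv` and exchanges the two singular lines
`{y = 0}` and `{y = -x}`. -/
def reversor : ℝ × ℝ ≃ₜ ℝ × ℝ where
  toFun p := (p.1, -p.1 - p.2)
  invFun p := (p.1, -p.1 - p.2)
  left_inv _ := Prod.ext rfl (sub_sub_cancel _ _)
  right_inv _ := Prod.ext rfl (sub_sub_cancel _ _)
  continuous_toFun := by fun_prop
  continuous_invFun := by fun_prop

theorem reversor_apply (p : ℝ × ℝ) : reversor p = (p.1, -p.1 - p.2) := rfl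

theorem hd_reversor (p : ℝ × ℝ) : hd (reversor p) = reversor (hdInv p) := by
  have hsnd : -p.1 - p.2 = -(p.1 + p.2) := by ring
  ext <;> simp only [reversor_apply, hd, hdInv, hsnd, div_neg] <;> ring

theorem iterate_hd_reversor (n : ℕ) (p : ℝ × ℝ) :
    hd^[n] (reversor p) = reversor (hdInv^[n] p) :=
  ((show Function.Semiconj reversor hdInv hd from fun p => (hd_reversor p).symm).iterate_right
    n p).symm

theorem reversor_mem_preAxis : reversor p ∈ preAxis n ↔ p ∈ imgAnti n := by
  induction n generalizing p with
  | zero => exact sub_eq_zero.trans eq_comm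
  | succ n ih =>
    have hsnd : (reversor p).2 ≠ 0 ↔ p.1 + p.2 ≠ 0 := by
      rw [reversor_apply, ← neg_add', neg_ne_zero]
    change (reversor p).2 ≠ 0 ∧ hd (reversor p) ∈ preAxis n ↔ _
    rw [hsnd, hd_reversor, ih]
    constructor
    · rintro ⟨hp, hmem⟩
      exact ⟨hdInv p, ⟨hmem, (hd_hdInv p hp).1⟩, (hd_hdInv p hp).2⟩
    · rintro ⟨q, ⟨hq, hq0⟩, rfl⟩
      obtain ⟨hne, hinv⟩ := hdInv_hd q hq0
      exact ⟨hne, by rwa [hinv]⟩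

theorem reversor_image_preAxis (n : ℕ) : reversor '' preAxis n = imgAnti n := by
  ext p
  rw [reversor.image_eq_preimage_symm]
  exact reversor_mem_preAxis

theorem reversor_image_graphOn (g : ℝ → ℝ) :
    reversor '' univ.graphOn g = univ.graphOn fun x => -x - g x := by
  rw [graphOn_univ_eq_range, graphOn_univ_eq_range, ← range_comp]
  rfl

theorem disjoint_imgAnti {m n : ℕ} (hmn : m ≠ n) : Disjoint (imgAnti m) (imgAnti n) := by
  rw [← reversor_image_preAxis, ← reversor_image_preAxis]
  exact disjoint_image_of_injective reversor.injective (disjoint_preAxis hmn)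

theorem curvesOf_image (e : ℝ × ℝ ≃ₜ ℝ × ℝ) (S : ℕ → Set (ℝ × ℝ)) :
    curvesOf (fun n => e '' S n) = (e '' ·) '' curvesOf S := by
  refine Subset.antisymm ?_ (image_subset_iff.2 ?_)
  · rintro _ ⟨n, _, ⟨p, hp, rfl⟩, rfl⟩
    exact ⟨_, ⟨n, p, hp, rfl⟩, e.image_connectedComponentIn hp⟩
  · rintro _ ⟨n, p, hp, rfl⟩
    exact ⟨n, e p, mem_image_of_mem e hp, e.image_connectedComponentIn hp⟩

theorem curvesOf_imgAnti : curvesOf imgAnti =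
    (univ.graphOn ·) '' ((fun g x => -x - g x) '' {g | ∃ n, IsLeaf n g}) := by
  rw [← funext reversor_image_preAxis, curvesOf_image, curvesOf_preAxis, image_image, image_image]
  simp only [reversor_image_graphOn]

theorem IsDenseGraphFamily.image_sub {X Y : Type*} [TopologicalSpace X] [TopologicalSpace Y]
    [AddCommGroup Y] [PartialOrder Y] [IsOrderedAddMonoid Y] [IsTopologicalAddGroup Y]
    {G : Set (X → Y)} (hG : IsDenseGraphFamily G) {u : X → Y} (hu : Continuous u) :
    IsDenseGraphFamily ((fun g x => u x - g x) '' G) where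
  continuous := forall_mem_image.2 fun g hg => hu.sub (hG.continuous g hg)
  eq_of_apply_eq := forall_mem_image.2 fun g hg => forall_mem_image.2 fun h hh x hx => by
    rw [hG.eq_of_apply_eq g hg h hh x (sub_right_injective hx)]
  dense x y y' hlt := by
    obtain ⟨g, hg, hlo, hhi⟩ := hG.dense x (u x - y') (u x - y) (sub_lt_sub_left hlt _)
    exact ⟨_, mem_image_of_mem _ hg, lt_sub_comm.1 hhi, sub_lt_comm.1 hlo⟩

theorem isLamination_imgAnti : IsLamination (curvesOf imgAnti) := by
  rw [curvesOf_imgAnti]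
  exact (isDenseGraphFamily_isLeaf.image_sub continuous_neg).isLamination
    (forall_mem_image.2 fun _ ⟨_, hg⟩ => contDiff_neg.sub hg.contDiff)

theorem one_deriv_mem_tangentVectors (hg : DifferentiableAt ℝ g p.1)
    (hp : p ∈ univ.graphOn g) : (1, deriv g p.1) ∈ tangentVectors (univ.graphOn g) p := by
  have hshift : HasDerivAt (fun t => p.1 + t) 1 0 := (hasDerivAt_id 0).const_add p.1
  refine ⟨fun t => (p.1 + t, g (p.1 + t)), fun t => mem_graphOn_univ.2 rfl,
    Prod.ext (add_zero _) (by simpa using hp), ?_⟩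
  have hg' : HasDerivAt g (deriv g p.1) (p.1 + 0) := by
    rw [add_zero]
    exact hg.hasDerivAt
  simpa using hshift.prodMk (hg'.comp 0 hshift)

theorem span_one_pair_eq_top {K : Type*} [Field K] {a b : K} (hab : a ≠ b) :
    Submodule.span K {((1 : K), a), (1, b)} = ⊤ := by
  refine eq_top_iff.2 fun w _ => Submodule.mem_span_pair.2
    ⟨w.1 - (w.2 - a * w.1) / (b - a), (w.2 - a * w.1) / (b - a), Prod.ext ?_ ?_⟩
  · simp
  · have hba : b - a ≠ 0 := sub_ne_zero.2 hab.symm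
    simp only [Prod.snd_add, Prod.smul_snd, smul_eq_mul]
    field_simp
    ring

theorem transverse_graphOn (hg : Differentiable ℝ g) (hh : Differentiable ℝ h)
    (hne : ∀ x, deriv g x ≠ deriv h x) : Transverse (univ.graphOn g) (univ.graphOn h) := by
  rintro p ⟨hpg, hph⟩
  refine eq_top_mono (Submodule.span_mono ?_) (span_one_pair_eq_top (hne p.1))
  exact pair_subset (.inl (one_deriv_mem_tangentVectors (hg p.1) hpg))
    (.inr (one_deriv_mem_tangentVectors (hh p.1) hph))

theorem transverse_of_mem_curvesOf {C D : Set (ℝ × ℝ)} (hC : C ∈ curvesOf preAxis)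
    (hD : D ∈ curvesOf imgAnti) : Transverse C D := by
  rw [curvesOf_preAxis] at hC
  rw [curvesOf_imgAnti] at hD
  obtain ⟨g, ⟨m, hg⟩, rfl⟩ := hC
  obtain ⟨_, ⟨h, ⟨n, hh⟩, rfl⟩, rfl⟩ := hD
  have hgd : Differentiable ℝ g := hg.contDiff.differentiable (by simp)
  have hhd : Differentiable ℝ h := hh.contDiff.differentiable (by simp)
  refine transverse_graphOn hgd (differentiable_neg.sub hhd) fun x => ne_of_gt ?_
  have hslope : HasDerivAt (fun x => -x - h x) (-1 - deriv h x) x :=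
    (hasDerivAt_neg x).sub (hhd x).hasDerivAt
  rw [hslope.deriv]
  linarith [hg.monotone.deriv_nonneg (x := x), hh.monotone.deriv_nonneg (x := x)]

end Reversor

section RisingPaths

/-- A continuous path in the plane which moves strictly to the right and never descends. -/
structure IsRisingOn {X : Type*} [TopologicalSpace X] [Preorder X] (γ : X → ℝ × ℝ)
    (K : Set X) : Prop where
  continuousOn : ContinuousOn γ K
  strictMonoOn_fst : StrictMonoOn (fun t => (γ t).1) K
  monotoneOn_snd : MonotoneOn (fun t => (γ t).2) K

namespace IsRisingOn

variable {X : Type*} [TopologicalSpace X] [PartialOrder X] {γ : X → ℝ × ℝ} {K : Set X}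

theorem strictMonoOn_fst_add_snd (hγ : IsRisingOn γ K) :
    StrictMonoOn (fun t => (γ t).1 + (γ t).2) K :=
  hγ.strictMonoOn_fst.add_monotone hγ.monotoneOn_snd

theorem hdInv_comp (hγ : IsRisingOn γ K) (hK : IsPreconnected K)
    (hne : ∀ t ∈ K, (γ t).1 + (γ t).2 ≠ 0) : IsRisingOn (fun t => hdInv (γ t)) K where
  continuousOn := continuousOn_hdInv.comp hγ.continuousOn hne
  strictMonoOn_fst _ hs _ ht hst := sub_lt_sub (hγ.strictMonoOn_fst hs ht hst)
    (one_div_lt_one_div_of_mul_pos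
      (mul_pos_of_isPreconnected hK (hγ.continuousOn.fst.add hγ.continuousOn.snd) hne hs ht)
      (hγ.strictMonoOn_fst_add_snd hs ht hst))
  monotoneOn_snd := hγ.strictMonoOn_fst_add_snd.monotoneOn

end IsRisingOn

variable {n : ℕ} {K : Set ℝ}

theorem preDomain_succ_subset (n : ℕ) : preDomain (n + 1) ⊆ preDomain n :=
  fun _ ht j hj => ht j (hj.trans n.lt_succ_self)

theorem isRisingOn_iterate_hdInv (hK : IsPreconnected K) (hKn : K ⊆ preDomain n) :
    IsRisingOn (fun t => hdInv^[n] (t, 0)) K := by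
  induction n with
  | zero =>
    exact ⟨continuousOn_id.prodMk continuousOn_const, strictMonoOn_id, monotoneOn_const⟩
  | succ n ih =>
    simp only [Function.iterate_succ_apply']
    exact (ih (hKn.trans (preDomain_succ_subset n))).hdInv_comp hK
      fun t ht => hKn ht n n.lt_succ_self

theorem strictMonoOn_snd_iterate_hdInv (hn : 1 ≤ n) (hK : IsPreconnected K)
    (hKn : K ⊆ preDomain n) : StrictMonoOn (fun t => (hdInv^[n] (t, 0)).2) K := by
  obtain ⟨m, rfl⟩ := Nat.exists_eq_add_of_le' hn
  simp only [Function.iterate_succ_apply']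
  exact (isRisingOn_iterate_hdInv hK
    (hKn.trans (preDomain_succ_subset m))).strictMonoOn_fst_add_snd

theorem iterate_hd_antidiagonal (n : ℕ) (t : ℝ) :
    hd^[n] (t, -t) = reversor (hdInv^[n] (t, 0)) := by
  rw [← iterate_hd_reversor, reversor_apply, sub_zero]

theorem imgDomain_eq_preDomain (n : ℕ) : imgDomain n = preDomain n := by
  ext t
  refine forall₂_congr fun j _ => ?_
  rw [iterate_hd_antidiagonal, reversor_apply, ← neg_add', neg_ne_zero]

theorem strictMonoOn_fst_iterate_hd (hK : IsPreconnected K) (hKn : K ⊆ imgDomain n) :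
    StrictMonoOn (fun t => (hd^[n] (t, -t)).1) K := by
  rw [imgDomain_eq_preDomain] at hKn
  simpa only [iterate_hd_antidiagonal, reversor_apply] using
    (isRisingOn_iterate_hdInv hK hKn).strictMonoOn_fst

theorem strictAntiOn_snd_iterate_hd (hK : IsPreconnected K) (hKn : K ⊆ imgDomain n) :
    StrictAntiOn (fun t => (hd^[n] (t, -t)).2) K := by
  rw [imgDomain_eq_preDomain] at hKn
  simp only [iterate_hd_antidiagonal, reversor_apply, ← neg_add']
  exact (isRisingOn_iterate_hdInv hK hKn).strictMonoOn_fst_add_snd.neg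

end RisingPaths

section TopLeaf

variable {n : ℕ} {p : ℝ × ℝ}

/-- The function whose graph is the highest component of `preAxis n`. -/
noncomputable def topLeaf (n : ℕ) : ℝ → ℝ := upperBranch^[n] fun _ => 0

theorem topLeaf_succ (n : ℕ) : topLeaf (n + 1) = upperBranch (topLeaf n) :=
  Function.iterate_succ_apply' _ _ _

theorem isLeaf_topLeaf (n : ℕ) : IsLeaf n (topLeaf n) := by
  induction n with
  | zero => exact .axis
  | succ n ih =>
    rw [topLeaf_succ]
    exact .upper ih

theorem snd_le_topLeaf_succ {x : ℝ} (hp : (hd p).2 ≤ topLeaf n (hd p).1) (hx : p.1 ≤ x) :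
    p.2 ≤ topLeaf (n + 1) x := by
  rw [topLeaf_succ]
  exact snd_le_upperBranch (isLeaf_topLeaf n).continuous (isLeaf_topLeaf n).monotone hp hx

theorem snd_le_topLeaf (hp : p ∈ preAxis n) : p.2 ≤ topLeaf n p.1 := by
  induction n generalizing p with
  | zero => exact hp.le
  | succ n ih => exact snd_le_topLeaf_succ (ih hp.2) le_rfl

theorem topLeaf_mem_graphOn_succ (n : ℕ) (x : ℝ) :
    0 < topLeaf (n + 1) x ∧ hd (x, topLeaf (n + 1) x) ∈ univ.graphOn (topLeaf n) := by
  rw [topLeaf_succ]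
  exact upperBranch_spec (isLeaf_topLeaf n).continuous (isLeaf_topLeaf n).monotone x

theorem monotone_topLeaf : Monotone topLeaf := by
  refine monotone_nat_of_le_succ fun n => ?_
  induction n with
  | zero => exact fun x => (topLeaf_mem_graphOn_succ 0 x).1.le
  | succ n ih =>
    refine fun x => snd_le_topLeaf_succ (p := (x, topLeaf (n + 1) x)) ?_ le_rfl
    rw [← mem_graphOn_univ.1 (topLeaf_mem_graphOn_succ n x).2]
    exact ih _

theorem tendsto_topLeaf (x : ℝ) : Tendsto (fun n => topLeaf n x) atTop atTop := by
  refine tendsto_atTop_atTop_of_monotone (fun _ _ hmn => monotone_topLeaf hmn x) fun b => ?_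
  obtain ⟨g, ⟨n, hg⟩, hbg, -⟩ := isDenseGraphFamily_isLeaf.dense x b (b + 1) (lt_add_one b)
  have hmem : (x, g x) ∈ preAxis n := hg.graphOn_subset_preAxis (mem_graphOn_univ.2 rfl)
  exact ⟨n, hbg.le.trans (snd_le_topLeaf hmem)⟩

theorem mem_graphOn_topLeaf : p ∈ univ.graphOn (topLeaf n) ↔
    ∃ t, (∀ j < n, 0 < (hdInv^[j] (t, 0)).1 + (hdInv^[j] (t, 0)).2) ∧ hdInv^[n] (t, 0) = p := by
  induction n generalizing p with
  | zero =>
    refine mem_graphOn_univ.trans ⟨fun h => ⟨p.1, by simp, Prod.ext rfl h⟩, ?_⟩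
    rintro ⟨t, -, rfl⟩
    rfl
  | succ n ih =>
    simp only [topLeaf_succ, (isLeaf_topLeaf n).mem_graphOn_upper, ih, Nat.forall_lt_succ_right,
      Function.iterate_succ_apply']
    constructor
    · rintro ⟨hp, t, ht, hpt⟩
      refine ⟨t, ⟨ht, ?_⟩, by rw [hpt, (hdInv_hd p hp.ne').2]⟩
      rwa [hpt, fst_add_snd_hd]
    · rintro ⟨t, ⟨ht, hpos⟩, rfl⟩
      exact ⟨hpos, t, ht, (hd_hdInv _ hpos.ne').2.symm⟩

theorem exists_iterate_hdInv_eq_topLeaf (n : ℕ) (x : ℝ) :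
    ∃ t₀, hdInv^[n] (t₀, 0) = (x, topLeaf n x) ∧
      ∀ t, ((∀ j < n, 0 < (hdInv^[j] (t, 0)).1 + (hdInv^[j] (t, 0)).2) ∧
        (hdInv^[n] (t, 0)).1 = x) ↔ t = t₀ := by
  obtain ⟨t₀, hpos₀, h₀⟩ := mem_graphOn_topLeaf.1
    (mem_graphOn_univ.2 rfl : (x, topLeaf n x) ∈ univ.graphOn (topLeaf n))
  refine ⟨t₀, h₀, fun t => ⟨fun ⟨hpos, hx⟩ => ?_, ?_⟩⟩
  · have htop : hdInv^[n] (t, 0) = (x, topLeaf n x) := by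
      have hmem := mem_graphOn_univ.1 (mem_graphOn_topLeaf.2 ⟨t, hpos, rfl⟩)
      exact Prod.ext hx (by rw [← hmem, hx])
    have heq : (t, (0 : ℝ)) = (t₀, 0) := by
      rw [← iterate_hd_iterate_hdInv fun j hj => (hpos j hj).ne', htop, ← h₀,
        iterate_hd_iterate_hdInv fun j hj => (hpos₀ j hj).ne']
    exact congrArg Prod.fst heq
  · rintro rfl
    exact ⟨hpos₀, congrArg Prod.fst h₀⟩

end TopLeaf

end HenonDevaney

theorem lemma1 :
    -- the two laminations and their transversality
    HenonDevaney.IsLamination (HenonDevaney.curvesOf HenonDevaney.preAxis) ∧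
    HenonDevaney.IsLamination (HenonDevaney.curvesOf HenonDevaney.imgAnti) ∧
    (∀ C ∈ HenonDevaney.curvesOf HenonDevaney.preAxis,
      ∀ D ∈ HenonDevaney.curvesOf HenonDevaney.imgAnti, HenonDevaney.Transverse C D) ∧
    -- pre-images of different orders are disjoint, and so are images of different orders
    (∀ m n : ℕ, m ≠ n → Disjoint (HenonDevaney.preAxis m) (HenonDevaney.preAxis n)) ∧
    (∀ m n : ℕ, m ≠ n → Disjoint (HenonDevaney.imgAnti m) (HenonDevaney.imgAnti n)) ∧
    -- monotonicity of the coordinates in the parameter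
    (∀ n : ℕ, 1 ≤ n → ∀ K ⊆ HenonDevaney.preDomain n, IsPreconnected K →
      StrictMonoOn (fun t : ℝ => (HenonDevaney.hdInv^[n] (t, 0)).1) K ∧
      StrictMonoOn (fun t : ℝ => (HenonDevaney.hdInv^[n] (t, 0)).2) K) ∧
    (∀ n : ℕ, ∀ K ⊆ HenonDevaney.imgDomain n, IsPreconnected K →
      StrictMonoOn (fun t : ℝ => (HenonDevaney.hd^[n] (t, -t)).1) K ∧
      StrictAntiOn (fun t : ℝ => (HenonDevaney.hd^[n] (t, -t)).2) K) ∧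
    -- the highest curve of order `n` meets the `y`-axis exactly once, and these points diverge
    (∃ τ : ℕ → ℝ,
      (∀ (n : ℕ) (t : ℝ),
        ((∀ j < n, 0 < (HenonDevaney.hdInv^[j] (t, 0)).1 + (HenonDevaney.hdInv^[j] (t, 0)).2) ∧
          (HenonDevaney.hdInv^[n] (t, 0)).1 = 0) ↔ t = τ n) ∧
      Tendsto (fun n => (HenonDevaney.hdInv^[n] (τ n, 0)).2) atTop atTop) := by
  choose τ hτ using fun n => HenonDevaney.exists_iterate_hdInv_eq_topLeaf n 0
  refine ⟨HenonDevaney.isLamination_preAxis, HenonDevaney.isLamination_imgAnti,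
    fun C hC D hD => HenonDevaney.transverse_of_mem_curvesOf hC hD,
    fun m n hmn => HenonDevaney.disjoint_preAxis hmn,
    fun m n hmn => HenonDevaney.disjoint_imgAnti hmn,
    fun n hn K hKn hK => ⟨(HenonDevaney.isRisingOn_iterate_hdInv hK hKn).strictMonoOn_fst,
      HenonDevaney.strictMonoOn_snd_iterate_hdInv hn hK hKn⟩,
    fun n K hKn hK => ⟨HenonDevaney.strictMonoOn_fst_iterate_hd hK hKn,
      HenonDevaney.strictAntiOn_snd_iterate_hd hK hKn⟩,
    τ, fun n => (hτ n).2, ?_⟩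
  simpa only [fun n => (hτ n).1] using HenonDevaney.tendsto_topLeaf 0
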